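/- Let $\kappa,\tau>0$. On $\mathbb R^4$ let $\langle u,v\rangle=u_1v_1+u_2v_2-u_3v_3-u_4v_4$ and $J_1q=(-q_2,q_1,-q_4,q_3)$. Let $\mathbb H=\mathbb H^3_1(\kappa/4)=\{q:\langle q,q\rangle=-4/\kappa\}$, with the fields $X_1(q)=\frac{\sqrt\kappa}{2}J_1q$ and $E_1=\tau^{-1}X_1$, and the Lorentzian metric $g_\tau(u,v)=\langle u,v\rangle+(1-\tau^2)\langle u,X_1\rangle\langle v,X_1\rangle$; write $\|v\|_\tau=\sqrt{|g_\tau(v,v)|}$. The hyperbolic Hopf fibers are the fibers of $h(z,w)=\frac{\sqrt\kappa}{4}(2z\bar w,|z|^2+|w|^2)$ on $\mathbb H$, where $z=q_1+iq_2$, $w=q_3+iq_4$. A helix surface is an immersed surface $M$ in $\mathbb H$ (smooth, non-empty) with a smooth unit normal field $N$, $g_\tau(N,N)=\lambda=\pm1$, such that $\nu=\lambda g_\tau(N,E_1)$ is constant; we assume $\nu\ne0$. A curve is spacelike (timelike) if $g_\tau(\gamma',\gamma')>0$ ($<0$) everywhere. A general helix is a curve with $g_\tau(\gamma',\gamma')\neq0$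 for which there is a Killing field $V$ of $(\mathbb H,g_\tau)$, called an axis, of constant length along $\gamma$ and such that the angle function $g_\tau(\gamma',V)/\|\gamma'\|_\tau$ is a non-zero constant. For $\lambda\in\{1,-1\}$ and $\nu\neq0$ with $\lambda+\nu^2>0$ put $B=\nu^2(\tau^2-1)-\lambda$ and define $\gamma=\gamma_{\lambda,\nu}:\mathbb R\to\mathbb R^4$ as follows. * If $B>0$: $$\gamma(x)=(\sqrt{w_{11}}\cos\alpha_1x,\,-\lambda\sqrt{w_{11}}\sin\alpha_1x,\,\sqrt{-w_{33}}\cos\alpha_2x,\,\lambda\sqrt{-w_{33}}\sin\alpha_2x),$$ with $\alpha_{1,2}=\frac{\sqrt\kappa}{2}\big(|\nu|\sqrt B\pm\frac B\tau\big)$, $w_{11}=\frac{4\tau}{\kappa^{3/2}B}\alpha_2$, $w_{33}=-\frac{4\tau}{\kappa^{3/2}B}\alpha_1$. * If $B=0$: $\gamma(x)=(\nu^2\tau x,\,0,\,\frac{2}{\sqrt\kappa},\,\nu^2\tau\lambda x)$. * If $B<0$: with $\alpha=-\frac{\sqrt\kappa}{2}\frac{B}{\lambda\tau}$, $\beta=|\nu|\frac{\sqrt{-\kappa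 B}}{2}$, $p=\frac{2\sqrt{\lambda+\nu^2}}{\sqrt{-\kappa B}}$, $r=\frac{2\lambda\tau|\nu|}{\sqrt{-\kappa B}}$, $$\gamma(x)=\big(p\cos\alpha x\sinh\beta x,\;p\sin\alpha x\sinh\beta x,\;\tfrac{2}{\sqrt\kappa}\cos\alpha x\cosh\beta x-r\sin\alpha x\sinh\beta x,\;\tfrac{2}{\sqrt\kappa}\sin\alpha x\cosh\beta x+r\cos\alpha x\sinh\beta x\big).$$ **Proposition 7.1.** 1. $E_1$ spans the tangent line of the Hopf fiber at each point of $\mathbb H$. 2. For all such $\lambda,\nu$, in each of the three cases, $\gamma$ is a smooth curve in $\mathbb H$, spacelike if $\lambda=-1$ and timelike if $\lambda=1$, and it is a general helix of $(\mathbb H,g_\tau)$ with axis $E_1$. It meets the Hopf fibers (oriented by $E_1$) at a constant angle, given in all three cases by the same formula $$\frac{g_\tau(\gamma',E_1)}{\|\gamma'\|_\tau}=-\lambda\sqrt{\lambda+\nu^2}.$$ 3. If $M$ is a helix surface with constants $\lambda$ and $\nu\ne0$, then $\lambda+\nu^2>0$, and $M$ is either spacelike or timelike. Its curve $\gamma_{\lambda,\nu}$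 is spacelike if and only if $M$ is spacelike, and timelike if and only if $M$ is timelike; so the conclusions of 2 hold for the curve of $M$. -/

import Mathlib

open scoped Manifold ContDiff

noncomputable section

namespace BergerAdS

/-- The space `ℝ⁴₂`; `(x₁,x₂,x₃,x₄)` is also the paraquaternion `x₁ + x₂ i + x₃ j + x₄ k` and the
pair of complex numbers `(x₁ + i x₂, x₃ + i x₄)`. -/
abbrev R42 : Type := Fin 4 → ℝ

/-- The flat metric `g₀ = dx₁² + dx₂² - dx₃² - dx₄²`. -/
def ip (u v : R42) : ℝ := u 0 * v 0 + u 1 * v 1 - u 2 * v 2 - u 3 * v 3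

/-- Multiplication by `i`. -/
def J1 (q : R42) : R42 := ![-q 1, q 0, -q 3, q 2]

/-- Multiplication by `j`. -/
def J2 (q : R42) : R42 := ![q 2, -q 3, q 0, -q 1]

/-- Multiplication by `k`. -/
def J3 (q : R42) : R42 := ![q 3, q 2, q 1, q 0]

/-- The anti-de Sitter space `ℍ³₁(c)`. The space studied here is `ℍ³₁(κ/4)`. -/
def antiDeSitter (c : ℝ) : Set R42 := {q | ip q q = -1 / c}

/-- `v` is tangent at `q` to the hyperquadric `antiDeSitter c` through `q`. -/
def IsTangentVec (q v : R42) : Prop := ip q v = 0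

/-- The hyperbolic Hopf vector field. -/
def X1 (κ : ℝ) (q : R42) : R42 := (√κ / 2) • J1 q

def X2 (κ : ℝ) (q : R42) : R42 := (√κ / 2) • J2 q

def X3 (κ : ℝ) (q : R42) : R42 := (√κ / 2) • J3 q

/-- The normalized Hopf vector field `E₁ = τ⁻¹ X₁`. -/
def E1 (κ τ : ℝ) (q : R42) : R42 := τ⁻¹ • X1 κ q

/-- The Berger-like metric `g_τ(u,v) = ⟨u,v⟩ + (1 - τ²) ⟨u,X₁⟩⟨v,X₁⟩` at the point `q`.
By the lemmas below it makes the tangent frame `X₁, X₂, X₃` of `ℍ³₁(κ/4)` orthogonal with squared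
lengths `-τ², 1, 1`. -/
def gB (κ τ : ℝ) (q u v : R42) : ℝ :=
  ip u v + (1 - τ ^ 2) * ip u (X1 κ q) * ip v (X1 κ q)

lemma isTangentVec_frame (κ : ℝ) (q : R42) :
    IsTangentVec q (X1 κ q) ∧ IsTangentVec q (X2 κ q) ∧ IsTangentVec q (X3 κ q) := by
  refine ⟨?_, ?_, ?_⟩ <;>
    simp [IsTangentVec, ip, X1, X2, X3, J1, J2, J3] <;> ring

lemma gB_frame {κ : ℝ} (hκ : 0 < κ) (τ : ℝ) {q : R42} (hq : q ∈ antiDeSitter (κ / 4)) :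
    gB κ τ q (X1 κ q) (X1 κ q) = -τ ^ 2 ∧ gB κ τ q (X2 κ q) (X2 κ q) = 1 ∧
    gB κ τ q (X3 κ q) (X3 κ q) = 1 ∧ gB κ τ q (X1 κ q) (X2 κ q) = 0 ∧
    gB κ τ q (X1 κ q) (X3 κ q) = 0 ∧ gB κ τ q (X2 κ q) (X3 κ q) = 0 := by
  have hs : √κ ^ 2 = κ := Real.sq_sqrt hκ.le
  have h0 : √κ ^ 2 * ip q q = -4 := by
    rw [hs, show ip q q = -1 / (κ / 4) from hq]; field_simp
  have h11 : ip (X1 κ q) (X1 κ q) = -1 := by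
    have : ip (X1 κ q) (X1 κ q) = (√κ ^ 2 * ip q q) / 4 := by
      simp [ip, X1, J1]; ring
    rw [this, h0]; norm_num
  have h22 : ip (X2 κ q) (X2 κ q) = 1 := by
    have : ip (X2 κ q) (X2 κ q) = -(√κ ^ 2 * ip q q) / 4 := by
      simp [ip, X2, J2]; ring
    rw [this, h0]; norm_num
  have h33 : ip (X3 κ q) (X3 κ q) = 1 := by
    have : ip (X3 κ q) (X3 κ q) = -(√κ ^ 2 * ip q q) / 4 := by
      simp [ip, X3, J3]; ring
    rw [this, h0]; norm_num
  have h12 : ip (X1 κ q) (X2 κ q) = 0 := by simp [ip, X1, X2, J1, J2]; ring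
  have h21 : ip (X2 κ q) (X1 κ q) = 0 := by simp [ip, X1, X2, J1, J2]; ring
  have h13 : ip (X1 κ q) (X3 κ q) = 0 := by simp [ip, X1, X3, J1, J3]; ring
  have h31 : ip (X3 κ q) (X1 κ q) = 0 := by simp [ip, X1, X3, J1, J3]; ring
  have h23 : ip (X2 κ q) (X3 κ q) = 0 := by simp [ip, X2, X3, J2, J3]; ring
  refine ⟨?_, ?_, ?_, ?_, ?_, ?_⟩ <;> simp only [gB, h11, h22, h33, h12, h21, h13, h31, h23] <;> ring

/-- The length `‖v‖_τ = √|g_τ(v,v)|`. -/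
def gLength (κ τ : ℝ) (q v : R42) : ℝ := √|gB κ τ q v v|

/-- A smooth vector field on `ℍ³₁(κ/4)`, given by a smooth extension to `ℝ⁴`
(`ℍ³₁(κ/4)` is a closed submanifold, so every smooth tangent field has one). -/
def IsTangentField (κ : ℝ) (V : R42 → R42) : Prop :=
  ContDiff ℝ ∞ V ∧ ∀ q ∈ antiDeSitter (κ / 4), IsTangentVec q (V q)

/-- `V` is a Killing field of `(ℍ³₁(κ/4), g_τ)`: the Lie derivative of `g_τ` along `V` vanishes,
`V(g_τ(X,Y)) = g_τ([V,X],Y) + g_τ(X,[V,Y])` for all smooth vector fields `X`, `Y` on `ℍ³₁(κ/4)`.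
(Values of both sides on `ℍ³₁(κ/4)` do not depend on the extensions chosen.) -/
def IsKilling (κ τ : ℝ) (V : R42 → R42) : Prop :=
  IsTangentField κ V ∧ ∀ X Y : R42 → R42, IsTangentField κ X → IsTangentField κ Y →
    ∀ q ∈ antiDeSitter (κ / 4),
      fderiv ℝ (fun p => gB κ τ p (X p) (Y p)) q (V q) =
        gB κ τ q (VectorField.lieBracket ℝ V X q) (Y q) +
        gB κ τ q (X q) (VectorField.lieBracket ℝ V Y q)

/-! ### Curves -/

def IsSpacelikeCurve (κ τ : ℝ) (γ : ℝ → R42) : Prop :=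
  ∀ x, 0 < gB κ τ (γ x) (deriv γ x) (deriv γ x)

def IsTimelikeCurve (κ τ : ℝ) (γ : ℝ → R42) : Prop :=
  ∀ x, gB κ τ (γ x) (deriv γ x) (deriv γ x) < 0

/-- The angle function `g_τ(γ', V) / ‖γ'‖_τ` between a curve and a vector field. -/
def angleFun (κ τ : ℝ) (γ : ℝ → R42) (V : R42 → R42) (x : ℝ) : ℝ :=
  gB κ τ (γ x) (deriv γ x) (V (γ x)) / gLength κ τ (γ x) (deriv γ x)

/-- `γ` is a general helix of `(ℍ³₁(κ/4), g_τ)` with axis `V`. -/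
structure IsGeneralHelix (κ τ : ℝ) (γ : ℝ → R42) (V : R42 → R42) : Prop where
  smooth : ContDiff ℝ ∞ γ
  mem : ∀ x, γ x ∈ antiDeSitter (κ / 4)
  non_null : ∀ x, gB κ τ (γ x) (deriv γ x) (deriv γ x) ≠ 0
  killing : IsKilling κ τ V
  const_length : ∃ l : ℝ, ∀ x, gB κ τ (γ x) (V (γ x)) (V (γ x)) = l
  const_angle : ∃ c : ℝ, c ≠ 0 ∧ ∀ x, angleFun κ τ γ V x = c

/-! ### The hyperbolic Hopf fibration -/

/-- The hyperbolic Hopf map `h(z,w) = (√κ/4) (2 z w̄, |z|² + |w|²)`. -/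
def hopfMap (κ : ℝ) (q : R42) : Fin 3 → ℝ :=
  (√κ / 4) • ![2 * (q 0 * q 2 + q 1 * q 3), 2 * (q 1 * q 2 - q 0 * q 3),
    q 0 ^ 2 + q 1 ^ 2 + q 2 ^ 2 + q 3 ^ 2]

/-- The Hopf fiber through `q`. -/
def hopfFiber (κ : ℝ) (q : R42) : Set R42 :=
  {p | p ∈ antiDeSitter (κ / 4) ∧ hopfMap κ p = hopfMap κ q}

/-- `v` is a tangent vector at `q` of the Hopf fiber through `q`. -/
def IsFiberDirection (κ : ℝ) (q v : R42) : Prop :=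
  ∃ σ : ℝ → R42, (∀ t, σ t ∈ hopfFiber κ q) ∧ σ 0 = q ∧ HasDerivAt σ v 0

/-- `γ` meets all Hopf fibers it crosses at the angle `c`, the fibers being oriented
by the timelike field `E₁`. -/
def MeetsHopfFibersAt (κ τ : ℝ) (γ : ℝ → R42) (c : ℝ) : Prop :=
  ∀ x v, IsFiberDirection κ (γ x) v → gB κ τ (γ x) v (E1 κ τ (γ x)) < 0 →
    gB κ τ (γ x) (deriv γ x) v / (gLength κ τ (γ x) (deriv γ x) * gLength κ τ (γ x) v) = c

/-- `γ` is a general helix with axis `E₁` whose angle with `E₁`, and with the Hopf fibers, is `c`. -/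
def IsHopfHelix (κ τ : ℝ) (γ : ℝ → R42) (c : ℝ) : Prop :=
  IsGeneralHelix κ τ γ (E1 κ τ) ∧ (∀ x, angleFun κ τ γ (E1 κ τ) x = c) ∧
    MeetsHopfFibersAt κ τ γ c

/-! ### The curves of the classification of helix surfaces

`lam` and `ν` are the causal sign and the angle function of the surface. -/

/-- The constant `B = ν² (τ² - 1) - λ`. -/
def constB (τ lam ν : ℝ) : ℝ := ν ^ 2 * (τ ^ 2 - 1) - lam

def alpha1 (κ τ lam ν : ℝ) : ℝ :=
  √κ / 2 * (|ν| * √(constB τ lam ν) + constB τ lam ν / τ)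

def alpha2 (κ τ lam ν : ℝ) : ℝ :=
  √κ / 2 * (|ν| * √(constB τ lam ν) - constB τ lam ν / τ)

def w11 (κ τ lam ν : ℝ) : ℝ :=
  4 * τ / (κ ^ (3 / 2 : ℝ) * constB τ lam ν) * alpha2 κ τ lam ν

def w33 (κ τ lam ν : ℝ) : ℝ :=
  -(4 * τ / (κ ^ (3 / 2 : ℝ) * constB τ lam ν)) * alpha1 κ τ lam ν

/-- The curve for `B > 0`. -/
def curvePos (κ τ lam ν : ℝ) (x : ℝ) : R42 :=
  ![√(w11 κ τ lam ν) * Real.cos (alpha1 κ τ lam ν * x),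
    -lam * √(w11 κ τ lam ν) * Real.sin (alpha1 κ τ lam ν * x),
    √(-w33 κ τ lam ν) * Real.cos (alpha2 κ τ lam ν * x),
    lam * √(-w33 κ τ lam ν) * Real.sin (alpha2 κ τ lam ν * x)]

/-- The curve for `B = 0`. -/
def curveZero (κ τ lam ν : ℝ) (x : ℝ) : R42 :=
  ![ν ^ 2 * τ * x, 0, 2 / √κ, ν ^ 2 * τ * lam * x]

def alphaNeg (κ τ lam ν : ℝ) : ℝ := -(√κ / 2) * (constB τ lam ν / (lam * τ))

def betaNeg (κ τ lam ν : ℝ) : ℝ := |ν| * (√(-κ * constB τ lam ν) / 2)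

/-- The curve for `B < 0`. -/
def curveNeg (κ τ lam ν : ℝ) (x : ℝ) : R42 :=
  let α := alphaNeg κ τ lam ν
  let β := betaNeg κ τ lam ν
  let p := 2 * √(lam + ν ^ 2) / √(-κ * constB τ lam ν)
  let r := 2 * lam * τ * |ν| / √(-κ * constB τ lam ν)
  ![p * Real.cos (α * x) * Real.sinh (β * x),
    p * Real.sin (α * x) * Real.sinh (β * x),
    2 / √κ * Real.cos (α * x) * Real.cosh (β * x) - r * Real.sin (α * x) * Real.sinh (β * x),
    2 / √κ * Real.sin (α * x) * Real.cosh (β * x) + r * Real.cos (α * x) * Real.sinh (β * x)]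

/-- `γ` is the curve attached to the constants `κ, τ, λ, ν` in the case `B > 0`, `B = 0` or `B < 0`
that applies. -/
def IsProfileCurve (κ τ lam ν : ℝ) (γ : ℝ → R42) : Prop :=
  (0 < constB τ lam ν ∧ γ = curvePos κ τ lam ν) ∨
  (constB τ lam ν = 0 ∧ γ = curveZero κ τ lam ν) ∨
  (constB τ lam ν < 0 ∧ γ = curveNeg κ τ lam ν)

/-! ### Helix surfaces -/

section Surfaces

variable {M : Type*} [TopologicalSpace M] [ChartedSpace (EuclideanSpace ℝ (Fin 2)) M]

/-- The differential of `F : M → ℝ⁴₂` applied to a tangent vector. -/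
def dF (F : M → R42) (p : M) (v : TangentSpace (𝓡 2) p) : R42 :=
  mfderiv (𝓡 2) 𝓘(ℝ, R42) F p v

/-- `F : M → ℍ³₁(κ/4)` is an immersed surface, oriented by the smooth unit normal `N` with
`g_τ(N,N) = λ = ±1`. (A non-null normal makes the induced metric non-degenerate.) -/
structure IsOrientedSurface (κ τ : ℝ) (F N : M → R42) (lam : ℝ) : Prop where
  smooth : ContMDiff (𝓡 2) 𝓘(ℝ, R42) ∞ F
  mem : ∀ p, F p ∈ antiDeSitter (κ / 4)
  immersion : ∀ p, Function.Injective (dF F p)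
  smooth_normal : ContMDiff (𝓡 2) 𝓘(ℝ, R42) ∞ N
  tangent_normal : ∀ p, IsTangentVec (F p) (N p)
  normal : ∀ p v, gB κ τ (F p) (dF F p v) (N p) = 0
  sign : lam = 1 ∨ lam = -1
  unit : ∀ p, gB κ τ (F p) (N p) (N p) = lam

/-- A helix surface: the angle function `λ g_τ(N, E₁)` is the constant `ν`. -/
structure IsHelixSurface (κ τ : ℝ) (F N : M → R42) (lam ν : ℝ) : Prop
    extends IsOrientedSurface κ τ F N lam where
  angle : ∀ p, lam * gB κ τ (F p) (N p) (E1 κ τ (F p)) = ν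

/-- The induced metric is positive definite. -/
def IsSpacelikeSurface (κ τ : ℝ) (F : M → R42) : Prop :=
  ∀ p v, v ≠ 0 → 0 < gB κ τ (F p) (dF F p v) (dF F p v)

/-- The induced metric is Lorentzian (a quadratic form in two variables is so exactly when it takes
both signs). -/
def IsTimelikeSurface (κ τ : ℝ) (F : M → R42) : Prop :=
  ∀ p, (∃ v, gB κ τ (F p) (dF F p v) (dF F p v) < 0) ∧
    ∃ v, 0 < gB κ τ (F p) (dF F p v) (dF F p v)

end Surfaces

end BergerAdS

end

namespace BergerAdS

/-! ### Algebra of the flat metric and of the Hopf frame -/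

/-! The Hopf fibers are the orbits of $q\mapsto e^{it}q$, so $E_1$ spans their tangents. This linear
flow preserves the flat metric and commutes with $J_1$, hence preserves $X_1$ and $g_\tau$: $E_1$ is
Killing (`isKilling_E1`), of squared length $-1$.

For the curves everything reduces to two scalar identities,
$\tau^2\langle\gamma',\gamma'\rangle=(\lambda+\nu^2)B$ and
$\tau\langle\gamma',X_1\rangle=-\lambda(\lambda+\nu^2)$. They make both $g_\tau(\gamma',\gamma')$
and $g_\tau(\gamma',E_1)$ equal to $-\lambda(\lambda+\nu^2)$, which gives causal character and angle
at once (`isHopfHelix_of_velocity`). The three cases of $B$ differ only in how the identities are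
checked.

For a helix surface, the horizontal part of $N$ has squared length $\lambda+\nu^2\ge0$. Equality
would make $N$ parallel to $E_1$ and the surface horizontal, which is impossible because the
horizontal distribution is a contact structure (`not_horizontal_immersion`). The sign $\lambda$ of
the normal decides the causal type of the surface, and also that of the curve, so the two types
agree. -/

lemma ip_comm (u v : R42) : ip u v = ip v u := by simp [ip]; ring

lemma ip_add_left (u u' v : R42) : ip (u + u') v = ip u v + ip u' v := by simp [ip]; ring

lemma ip_smul_left (s : ℝ) (u v : R42) : ip (s • u) v = s * ip u v := by simp [ip]; ring

lemma ip_smul_right (s : ℝ) (u v : R42) : ip u (s • v) = s * ip u v := by simp [ip]; ring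

lemma ip_J1_left (u v : R42) : ip (J1 u) v = -ip u (J1 v) := by simp [ip, J1]; ring

lemma X1_eq (κ : ℝ) (q : R42) : X1 κ q = (√κ / 2) • J1 q := rfl

/-- Multiplication by `i` as a continuous linear map. -/
noncomputable def J1L : R42 →L[ℝ] R42 :=
  LinearMap.toContinuousLinearMap
    { toFun := J1
      map_add' := fun u v => by ext i; fin_cases i <;> simp [J1] <;> ring
      map_smul' := fun s u => by ext i; fin_cases i <;> simp [J1] }

lemma J1L_apply (u : R42) : J1L u = J1 u := rfl

lemma E1_eq (κ τ : ℝ) : E1 κ τ = fun q => ((τ⁻¹ * (√κ / 2)) • J1L) q := by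
  funext q
  simp [E1, X1, J1L_apply, smul_smul]

/-- Product rule. The derivative is given only through its values, which is all that later
uniqueness-of-derivative arguments need. -/
lemma hasFDerivAt_ip {E : Type*} [NormedAddCommGroup E] [NormedSpace ℝ E] {u v : E → R42}
    {u' v' : E →L[ℝ] R42} {x : E} (hu : HasFDerivAt u u' x) (hv : HasFDerivAt v v' x) :
    ∃ L : E →L[ℝ] ℝ, HasFDerivAt (fun y => ip (u y) (v y)) L x ∧
      ∀ w, L w = ip (u' w) (v x) + ip (u x) (v' w) := by
  have hu' := hasFDerivAt_pi'.1 hu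
  have hv' := hasFDerivAt_pi'.1 hv
  refine ⟨_, ((((hu' 0).mul (hv' 0)).add ((hu' 1).mul (hv' 1))).sub
    ((hu' 2).mul (hv' 2))).sub ((hu' 3).mul (hv' 3)), fun w => ?_⟩
  simp [ip]
  ring

section Frame

variable {κ : ℝ} {q : R42}

lemma ip_X1_X1 (hκ : 0 < κ) (hq : q ∈ antiDeSitter (κ / 4)) : ip (X1 κ q) (X1 κ q) = -1 := by
  have h : ip q q = -1 / (κ / 4) := hq
  have : ip (X1 κ q) (X1 κ q) = (√κ ^ 2 * ip q q) / 4 := by simp [ip, X1, J1]; ring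
  rw [this, Real.sq_sqrt hκ.le, h]
  field_simp

/-- Since $\langle X_1,X_1\rangle=-1$, the correction term turns the factor $1$ into
$1-(1-\tau^2)=\tau^2$, and $E_1=\tau^{-1}X_1$ leaves $\tau$. -/
lemma gB_E1_right (hκ : 0 < κ) {τ : ℝ} (hτ : 0 < τ) (hq : q ∈ antiDeSitter (κ / 4)) (u : R42) :
    gB κ τ q u (E1 κ τ q) = τ * ip u (X1 κ q) := by
  simp only [gB, E1, ip_smul_left, ip_smul_right, ip_X1_X1 hκ hq]
  field_simp
  ring

lemma gB_E1_E1 (hκ : 0 < κ) {τ : ℝ} (hτ : 0 < τ) (hq : q ∈ antiDeSitter (κ / 4)) :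
    gB κ τ q (E1 κ τ q) (E1 κ τ q) = -1 := by
  rw [gB_E1_right hκ hτ hq, E1, ip_smul_left, ip_X1_X1 hκ hq]
  field_simp

lemma gB_smul_left (κ τ : ℝ) (q : R42) (s : ℝ) (u v : R42) :
    gB κ τ q (s • u) v = s * gB κ τ q u v := by
  simp only [gB, ip_smul_left]; ring

lemma gB_smul_right (κ τ : ℝ) (q : R42) (s : ℝ) (u v : R42) :
    gB κ τ q u (s • v) = s * gB κ τ q u v := by
  simp only [gB, ip_smul_left, ip_smul_right]; ring

lemma gB_add_left (κ τ : ℝ) (q : R42) (u u' v : R42) :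
    gB κ τ q (u + u') v = gB κ τ q u v + gB κ τ q u' v := by
  simp only [gB, ip_add_left]; ring

/-- Expansion of a tangent vector in the Hopf frame. -/
lemma exists_frame_coords (hκ : 0 < κ) (hq : q ∈ antiDeSitter (κ / 4)) {u : R42}
    (hu : IsTangentVec q u) : ∃ a b c : ℝ, u = a • X1 κ q + b • X2 κ q + c • X3 κ q := by
  have h : ip q q = -1 / (κ / 4) := hq
  have hs : √κ ^ 2 = κ := Real.sq_sqrt hκ.le
  have h0 : √κ ^ 2 * ip q q = -4 := by rw [hs, h]; field_simp
  have hu : ip q u = 0 := hu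
  -- Orthogonal expansion: the frame has flat squared lengths $-1,1,1$, and the remaining component
  -- along $q$ vanishes by tangency.
  refine ⟨-ip u (X1 κ q), ip u (X2 κ q), ip u (X3 κ q), ?_⟩
  simp only [ip] at h0 hu
  ext i
  fin_cases i <;> simp [ip, X1, X2, X3, J1, J2, J3]
  · linear_combination (u 0 / 4) * h0 - (q 0 * √κ ^ 2 / 4) * hu
  · linear_combination (u 1 / 4) * h0 - (q 1 * √κ ^ 2 / 4) * hu
  · linear_combination (u 2 / 4) * h0 - (q 2 * √κ ^ 2 / 4) * hu
  · linear_combination (u 3 / 4) * h0 - (q 3 * √κ ^ 2 / 4) * hu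

lemma isTangentVec_frame_comb (κ : ℝ) (q : R42) (a b c : ℝ) :
    IsTangentVec q (a • X1 κ q + b • X2 κ q + c • X3 κ q) := by
  simp [IsTangentVec, ip, X1, X2, X3, J1, J2, J3]; ring

/-- The metric `g_τ` in coordinates with respect to the Hopf frame. -/
lemma gB_frame_comb (hκ : 0 < κ) (τ : ℝ) (hq : q ∈ antiDeSitter (κ / 4)) (a b c a' b' c' : ℝ) :
    gB κ τ q (a • X1 κ q + b • X2 κ q + c • X3 κ q) (a' • X1 κ q + b' • X2 κ q + c' • X3 κ q) =
      -τ ^ 2 * a * a' + b * b' + c * c' := by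
  have comm : ∀ u v, gB κ τ q u v = gB κ τ q v u := fun u v => by
    simp only [gB, ip_comm u v]; ring
  have addr : ∀ u v w, gB κ τ q u (v + w) = gB κ τ q u v + gB κ τ q u w := fun u v w => by
    rw [comm, gB_add_left, comm v, comm w]
  obtain ⟨h11, h22, h33, h12, h13, h23⟩ := gB_frame hκ τ hq
  simp only [gB_add_left, addr, gB_smul_left, gB_smul_right, h11, h22, h33, h12, h13, h23,
    comm (X2 κ q) (X1 κ q), comm (X3 κ q) (X1 κ q), comm (X3 κ q) (X2 κ q)]
  ring

end Frame

/-! ### The Hopf fibers and the Killing field `E₁` -/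

/-- Along a curve in a fiber, $z\bar w$, $|z|^2$ and $|w|^2$ are constant. The last gives $w'=isw$
with $s$ real, and then constancy of $z\bar w$ with $w\neq0$ gives $z'=isz$. -/
theorem isFiberDirection_iff {κ τ : ℝ} (hκ : 0 < κ) (hτ : 0 < τ) {q : R42}
    (hq : q ∈ antiDeSitter (κ / 4)) (v : R42) :
    IsFiberDirection κ q v ↔ ∃ s : ℝ, v = s • E1 κ τ q := by
  have hk : 0 < √κ := Real.sqrt_pos.2 hκ
  have hqq : ip q q = -1 / (κ / 4) := hq
  constructor
  · rintro ⟨σ, hσ, h0, hd⟩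
    have hc := hasDerivAt_pi.1 hd
    have key : ∀ (G : ℝ → ℝ) (c d : ℝ), (∀ t, G t = c) → HasDerivAt G d 0 → d = 0 :=
      fun G c d hG hGd => by
        rw [show G = fun _ => c from funext hG] at hGd
        exact hGd.unique (hasDerivAt_const _ _)
    have hh : ∀ t, hopfMap κ (σ t) = hopfMap κ q := fun t => (hσ t).2
    have hm : ∀ t, ip (σ t) (σ t) = -1 / (κ / 4) := fun t => (hσ t).1
    have e0 := key (fun t => (σ t 0 * σ t 2 + σ t 1 * σ t 3)) (q 0 * q 2 + q 1 * q 3) _ (fun t => by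
      have := congrFun (hh t) 0
      simpa [hopfMap, hk.ne'] using this)
      (((hc 0).mul (hc 2)).add ((hc 1).mul (hc 3)))
    have e1 := key (fun t => (σ t 1 * σ t 2 - σ t 0 * σ t 3)) (q 1 * q 2 - q 0 * q 3) _ (fun t => by
      have := congrFun (hh t) 1
      simpa [hopfMap, hk.ne'] using this)
      (((hc 1).mul (hc 2)).sub ((hc 0).mul (hc 3)))
    have e2 := key (fun t => (σ t 0 * σ t 0 + σ t 1 * σ t 1 + σ t 2 * σ t 2 + σ t 3 * σ t 3))
      (q 0 ^ 2 + q 1 ^ 2 + q 2 ^ 2 + q 3 ^ 2) _ (fun t => by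
      have := congrFun (hh t) 2
      simp [hopfMap, hk.ne'] at this
      linear_combination this)
      (((((hc 0).mul (hc 0)).add ((hc 1).mul (hc 1))).add ((hc 2).mul (hc 2))).add
        ((hc 3).mul (hc 3)))
    have e3 := key (fun t => (σ t 0 * σ t 0 + σ t 1 * σ t 1 - σ t 2 * σ t 2 - σ t 3 * σ t 3))
      (-1 / (κ / 4)) _ hm
      (((((hc 0).mul (hc 0)).add ((hc 1).mul (hc 1))).sub ((hc 2).mul (hc 2))).sub
        ((hc 3).mul (hc 3)))
    simp only [h0] at e0 e1 e2 e3
    -- On the quadric $|w|^2=|z|^2+4/\kappa>0$.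
    have hR : 0 < q 2 ^ 2 + q 3 ^ 2 := by
      have : -1 / (κ / 4) < 0 := div_neg_of_neg_of_pos (by norm_num) (by positivity)
      rw [← hqq] at this
      simp only [ip] at this
      nlinarith [sq_nonneg (q 0), sq_nonneg (q 1)]
    have hw : q 2 * v 2 + q 3 * v 3 = 0 := by linear_combination e2 / 4 - e3 / 4
    -- The quotient is $\operatorname{Im}(\bar w w')/|w|^2$, the coefficient of $J_1q$; the factor
    -- $2\tau/\sqrt\kappa$ converts it to a coefficient of $E_1$.
    refine ⟨(q 2 * v 3 - q 3 * v 2) / (q 2 ^ 2 + q 3 ^ 2) * (2 * τ / √κ), ?_⟩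
    have hE : ∀ x : ℝ, (x * (2 * τ / √κ)) • E1 κ τ q = x • J1 q := fun x => by
      rw [E1, X1, smul_smul, smul_smul]
      congr 1
      field_simp
    rw [hE]
    ext i
    fin_cases i <;> simp [J1] <;> field_simp
    · linear_combination q 2 * e0 - q 3 * e1 - q 0 * hw
    · linear_combination q 3 * e0 + q 2 * e1 - q 1 * hw
    · linear_combination q 2 * hw
    · linear_combination q 3 * hw
  · rintro ⟨s, rfl⟩
    set c : ℝ := s * (τ⁻¹ * (√κ / 2)) with hc
    -- The orbit $e^{ict}q$, with $c$ fixed by the initial velocity $sE_1$.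
    refine ⟨fun t => Real.cos (c * t) • q + Real.sin (c * t) • J1 q, fun t => ⟨?_, ?_⟩, ?_, ?_⟩
    · change ip _ _ = _
      rw [← hqq]
      have := Real.sin_sq_add_cos_sq (c * t)
      simp only [ip, J1, Pi.add_apply, Pi.smul_apply, smul_eq_mul, Matrix.cons_val]
      linear_combination (q 0 ^ 2 + q 1 ^ 2 - q 2 ^ 2 - q 3 ^ 2) * this
    · have := Real.sin_sq_add_cos_sq (c * t)
      ext i
      fin_cases i <;> simp [hopfMap, J1, hk.ne']
      · linear_combination (q 0 * q 2 + q 1 * q 3) * this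
      · linear_combination (q 1 * q 2 - q 0 * q 3) * this
      · linear_combination (q 0 ^ 2 + q 1 ^ 2 + q 2 ^ 2 + q 3 ^ 2) * this
    · simp
    · have h1 : HasDerivAt (fun t : ℝ => c * t) c 0 := by
        simpa using (hasDerivAt_id (0 : ℝ)).const_mul c
      have := (h1.cos.smul_const q).add (h1.sin.smul_const (J1 q))
      refine this.congr_deriv ?_
      simp [E1, X1, smul_smul, hc]

theorem isKilling_E1 (κ τ : ℝ) : IsKilling κ τ (E1 κ τ) := by
  refine ⟨⟨?_, fun q _ => ?_⟩, fun X Y hX hY q _ => ?_⟩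
  · rw [E1_eq]
    exact ContinuousLinearMap.contDiff _
  · simp [IsTangentVec, ip, E1, X1, J1]; ring
  · have hXd := ((hX.1.differentiable (by simp)) q).hasFDerivAt
    have hYd := ((hY.1.differentiable (by simp)) q).hasFDerivAt
    have hEd : HasFDerivAt (E1 κ τ) ((τ⁻¹ * (√κ / 2)) • J1L) q := by
      rw [E1_eq]; exact ContinuousLinearMap.hasFDerivAt _
    have hX1 : HasFDerivAt (X1 κ) ((√κ / 2) • J1L) q :=
      ((√κ / 2) • J1L).hasFDerivAt
    obtain ⟨L1, h1, h1'⟩ := hasFDerivAt_ip hXd hYd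
    obtain ⟨L2, h2, h2'⟩ := hasFDerivAt_ip hXd hX1
    obtain ⟨L3, h3, h3'⟩ := hasFDerivAt_ip hYd hX1
    have hG : HasFDerivAt (fun p => gB κ τ p (X p) (Y p)) _ q :=
      h1.add ((h2.const_mul (1 - τ ^ 2)).mul h3)
    rw [hG.fderiv]
    simp only [VectorField.lieBracket, hEd.fderiv]
    simp only [add_apply, smul_apply, smul_eq_mul, h1', h2', h3', J1L_apply, gB]
    -- The derivatives of $X$ and $Y$ along $E_1$ cancel between the two sides; what remains is
    -- skewness of $J_1$, a polynomial identity.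
    generalize fderiv ℝ X q (E1 κ τ q) = x
    generalize fderiv ℝ Y q (E1 κ τ q) = y
    simp only [E1, X1, ip, J1, Pi.smul_apply, Pi.sub_apply, smul_eq_mul, Matrix.cons_val]
    ring

/-- Criterion for a curve to be a general helix with axis `E₁`. -/
theorem isHopfHelix_of_velocity {κ τ lam ν : ℝ} (hκ : 0 < κ) (hτ : 0 < τ)
    (hlam : lam = 1 ∨ lam = -1) (hpos : 0 < lam + ν ^ 2) {γ : ℝ → R42} (hγ : ContDiff ℝ ∞ γ)
    (hmem : ∀ x, γ x ∈ antiDeSitter (κ / 4))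
    (hip : ∀ x, τ ^ 2 * ip (deriv γ x) (deriv γ x) = (lam + ν ^ 2) * constB τ lam ν)
    (hX : ∀ x, τ * ip (deriv γ x) (X1 κ (γ x)) = -lam * (lam + ν ^ 2)) :
    (∀ x, gB κ τ (γ x) (deriv γ x) (deriv γ x) = -lam * (lam + ν ^ 2)) ∧
      IsHopfHelix κ τ γ (-lam * √(lam + ν ^ 2)) := by
  have hl2 : lam ^ 2 = 1 := by rcases hlam with rfl | rfl <;> norm_num
  have hl0 : lam ≠ 0 := by rintro rfl; norm_num at hl2
  have hg : ∀ x, gB κ τ (γ x) (deriv γ x) (deriv γ x) = -lam * (lam + ν ^ 2) := fun x => by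
    have h1 := hip x
    have h2 := hX x
    have : τ ^ 2 ≠ 0 := by positivity
    apply mul_left_cancel₀ this
    simp only [gB]
    -- $B$ is such that $B+(1-\tau^2)(\lambda+\nu^2)=-\lambda\tau^2$.
    unfold constB at h1
    set b := ip (deriv γ x) (X1 κ (γ x))
    linear_combination h1 + (1 - τ ^ 2) * (τ * b - lam * (lam + ν ^ 2)) * h2 +
      (1 - τ ^ 2) * (lam + ν ^ 2) ^ 2 * hl2
  have hs : 0 < √(lam + ν ^ 2) := Real.sqrt_pos.2 hpos
  have hlen : ∀ x, gLength κ τ (γ x) (deriv γ x) = √(lam + ν ^ 2) := fun x => by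
    rw [gLength, hg]
    congr 1
    rw [abs_mul, abs_of_pos hpos, abs_neg]
    rcases hlam with rfl | rfl <;> simp
  have hang : ∀ x, gB κ τ (γ x) (deriv γ x) (E1 κ τ (γ x)) / √(lam + ν ^ 2) =
      -lam * √(lam + ν ^ 2) := fun x => by
    rw [gB_E1_right hκ hτ (hmem x), hX, div_eq_iff hs.ne', mul_assoc, Real.mul_self_sqrt hpos.le]
  have hang' : ∀ x, angleFun κ τ γ (E1 κ τ) x = -lam * √(lam + ν ^ 2) := fun x => by
    rw [angleFun, hlen, hang]
  refine ⟨hg, ⟨hγ, hmem, fun x => ?_, isKilling_E1 κ τ, ⟨-1, fun x => gB_E1_E1 hκ hτ (hmem x)⟩,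
    _, ?_, hang'⟩, hang', fun x v hv hneg => ?_⟩
  · rw [hg]; exact mul_ne_zero (neg_ne_zero.2 hl0) hpos.ne'
  · exact mul_ne_zero (neg_ne_zero.2 hl0) hs.ne'
  · obtain ⟨s, rfl⟩ := (isFiberDirection_iff hκ hτ (hmem x) v).1 hv
    rw [gB_smul_left, gB_E1_E1 hκ hτ (hmem x)] at hneg
    have hs0 : 0 < s := by linarith
    have : gLength κ τ (γ x) (s • E1 κ τ (γ x)) = s := by
      rw [gLength, gB_smul_left, gB_smul_right, gB_E1_E1 hκ hτ (hmem x),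
        show s * (s * -1) = -(s * s) by ring, abs_neg, abs_mul_self, Real.sqrt_mul_self hs0.le]
    rw [this, hlen, gB_smul_right, ← hang x]
    field_simp

/-! ### The curves of the classification -/

section Curves

variable {κ τ lam ν : ℝ}

lemma hasDerivAt_vec4 {f : ℝ → R42} {v : R42} {x : ℝ}
    (h0 : HasDerivAt (fun x => f x 0) (v 0) x) (h1 : HasDerivAt (fun x => f x 1) (v 1) x)
    (h2 : HasDerivAt (fun x => f x 2) (v 2) x) (h3 : HasDerivAt (fun x => f x 3) (v 3) x) :
    HasDerivAt f v x := by
  rw [hasDerivAt_pi]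
  intro i
  fin_cases i <;> assumption

lemma hasDerivAt_cos_mul (a x : ℝ) :
    HasDerivAt (fun x => Real.cos (a * x)) (-a * Real.sin (a * x)) x := by
  have := (((hasDerivAt_id x).const_mul a)).cos
  refine this.congr_deriv ?_
  simp; ring

lemma hasDerivAt_sin_mul (a x : ℝ) :
    HasDerivAt (fun x => Real.sin (a * x)) (a * Real.cos (a * x)) x := by
  have := (((hasDerivAt_id x).const_mul a)).sin
  refine this.congr_deriv ?_
  simp; ring

lemma hasDerivAt_cosh_mul (a x : ℝ) :
    HasDerivAt (fun x => Real.cosh (a * x)) (a * Real.sinh (a * x)) x := by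
  have := (((hasDerivAt_id x).const_mul a)).cosh
  refine this.congr_deriv ?_
  simp; ring

lemma hasDerivAt_sinh_mul (a x : ℝ) :
    HasDerivAt (fun x => Real.sinh (a * x)) (a * Real.cosh (a * x)) x := by
  have := (((hasDerivAt_id x).const_mul a)).sinh
  refine this.congr_deriv ?_
  simp; ring

lemma contDiff_vec4 {n : ℕ∞ω} {a b c d : ℝ → ℝ} (ha : ContDiff ℝ n a) (hb : ContDiff ℝ n b)
    (hc : ContDiff ℝ n c) (hd : ContDiff ℝ n d) :
    ContDiff ℝ n (fun x => (![a x, b x, c x, d x] : R42)) := by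
  rw [contDiff_pi]
  intro i
  fin_cases i <;> assumption

/-- A curve on a torus, with the two factors rotating in opposite senses. -/
lemma isHopfHelix_torus (hκ : 0 < κ) (hτ : 0 < τ) (hlam : lam = 1 ∨ lam = -1)
    (hpos : 0 < lam + ν ^ 2) {A C a c : ℝ} (hAC : A ^ 2 - C ^ 2 = -1 / (κ / 4))
    (hv : τ ^ 2 * (A ^ 2 * a ^ 2 - C ^ 2 * c ^ 2) = (lam + ν ^ 2) * constB τ lam ν)
    (hX : τ * (√κ / 2) * (A ^ 2 * a + C ^ 2 * c) = lam + ν ^ 2) :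
    let γ : ℝ → R42 := fun x => ![A * Real.cos (a * x), -lam * A * Real.sin (a * x),
      C * Real.cos (c * x), lam * C * Real.sin (c * x)]
    (∀ x, gB κ τ (γ x) (deriv γ x) (deriv γ x) = -lam * (lam + ν ^ 2)) ∧
      IsHopfHelix κ τ γ (-lam * √(lam + ν ^ 2)) := by
  intro γ
  have hl2 : lam ^ 2 = 1 := by rcases hlam with rfl | rfl <;> norm_num
  have hd : ∀ x, deriv γ x = ![A * (-a * Real.sin (a * x)), -lam * A * (a * Real.cos (a * x)),
      C * (-c * Real.sin (c * x)), lam * C * (c * Real.cos (c * x))] := fun x =>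
    (hasDerivAt_vec4 ((hasDerivAt_cos_mul a x).const_mul A)
      ((hasDerivAt_sin_mul a x).const_mul (-lam * A)) ((hasDerivAt_cos_mul c x).const_mul C)
      ((hasDerivAt_sin_mul c x).const_mul (lam * C))).deriv
  refine isHopfHelix_of_velocity hκ hτ hlam hpos ?_ (fun x => ?_) (fun x => ?_) (fun x => ?_)
  · apply contDiff_vec4 <;> fun_prop
  · have h1 := Real.sin_sq_add_cos_sq (a * x)
    have h2 := Real.sin_sq_add_cos_sq (c * x)
    change ip _ _ = _
    simp only [ip, γ, Matrix.cons_val]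
    linear_combination hAC + A ^ 2 * h1 - C ^ 2 * h2 +
      (A ^ 2 * Real.sin (a * x) ^ 2 - C ^ 2 * Real.sin (c * x) ^ 2) * hl2
  · have h1 := Real.sin_sq_add_cos_sq (a * x)
    have h2 := Real.sin_sq_add_cos_sq (c * x)
    rw [hd]
    simp only [ip, Matrix.cons_val]
    linear_combination hv + τ ^ 2 * A ^ 2 * a ^ 2 * h1 - τ ^ 2 * C ^ 2 * c ^ 2 * h2 +
      τ ^ 2 * (A ^ 2 * a ^ 2 * Real.cos (a * x) ^ 2 - C ^ 2 * c ^ 2 * Real.cos (c * x) ^ 2) * hl2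
  · have h1 := Real.sin_sq_add_cos_sq (a * x)
    have h2 := Real.sin_sq_add_cos_sq (c * x)
    rw [hd]
    simp only [ip, X1, J1, γ, Pi.smul_apply, smul_eq_mul, Matrix.cons_val]
    linear_combination -lam * hX - lam * τ * (√κ / 2) * (A ^ 2 * a * h1 + C ^ 2 * c * h2)

/-- The squared radii are proportional to $\alpha_2$ and $\alpha_1$, so the torus conditions involve
only $\alpha_1-\alpha_2$ and $\alpha_1\alpha_2$. -/
lemma isHopfHelix_curvePos (hκ : 0 < κ) (hτ : 0 < τ) (hlam : lam = 1 ∨ lam = -1) (hν : ν ≠ 0)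
    (hpos : 0 < lam + ν ^ 2) (hB : 0 < constB τ lam ν) :
    (∀ x, gB κ τ (curvePos κ τ lam ν x) (deriv (curvePos κ τ lam ν) x)
        (deriv (curvePos κ τ lam ν) x) = -lam * (lam + ν ^ 2)) ∧
      IsHopfHelix κ τ (curvePos κ τ lam ν) (-lam * √(lam + ν ^ 2)) := by
  have hk : 0 < √κ := Real.sqrt_pos.2 hκ
  have hk2 : √κ ^ 2 = κ := Real.sq_sqrt hκ.le
  have hk3 : κ ^ (3 / 2 : ℝ) = √κ ^ 3 := by
    rw [Real.sqrt_eq_rpow, ← Real.rpow_natCast, ← Real.rpow_mul hκ.le]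
    norm_num
  have hS2 : √(constB τ lam ν) ^ 2 = constB τ lam ν := Real.sq_sqrt hB.le
  have hS : 0 < √(constB τ lam ν) := Real.sqrt_pos.2 hB
  have hn2 : |ν| ^ 2 = ν ^ 2 := sq_abs ν
  have hn : 0 < |ν| := abs_pos.2 hν
  have ha1 : 0 < alpha1 κ τ lam ν := by unfold alpha1; positivity
  -- Needed for $w_{11}\ge0$, so that its square root squares back. It amounts to $B\le\tau^2\nu^2$,
  -- which is where $\lambda+\nu^2>0$ enters.
  have ha2 : 0 ≤ alpha2 κ τ lam ν := by
    have : √(constB τ lam ν) / τ ≤ |ν| := by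
      rw [div_le_iff₀ hτ]
      apply Real.sqrt_le_iff.2 ⟨by positivity, ?_⟩
      rw [mul_pow, hn2]; unfold constB; nlinarith
    have h2 : constB τ lam ν / τ ≤ |ν| * √(constB τ lam ν) := by
      calc constB τ lam ν / τ = √(constB τ lam ν) / τ * √(constB τ lam ν) := by
            rw [div_mul_eq_mul_div, ← pow_two, hS2]
        _ ≤ _ := by gcongr
    unfold alpha2
    exact mul_nonneg (by positivity) (by linarith)
  have hw1 : 0 ≤ w11 κ τ lam ν := by unfold w11; positivity
  have hw3 : 0 ≤ -w33 κ τ lam ν := by unfold w33; rw [neg_mul, neg_neg]; positivity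
  have e1 : √(w11 κ τ lam ν) ^ 2 = 4 * τ / (√κ ^ 3 * constB τ lam ν) * alpha2 κ τ lam ν := by
    rw [Real.sq_sqrt hw1, w11, hk3]
  have e3 : √(-w33 κ τ lam ν) ^ 2 = 4 * τ / (√κ ^ 3 * constB τ lam ν) * alpha1 κ τ lam ν := by
    rw [Real.sq_sqrt hw3, w33, hk3]; ring
  have hdiff : alpha1 κ τ lam ν - alpha2 κ τ lam ν = √κ * constB τ lam ν / τ := by
    unfold alpha1 alpha2; ring
  have hprod : alpha1 κ τ lam ν * alpha2 κ τ lam ν =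
      √κ ^ 2 / 4 * (constB τ lam ν * (lam + ν ^ 2) / τ ^ 2) := by
    have : ν ^ 2 - constB τ lam ν / τ ^ 2 = (lam + ν ^ 2) / τ ^ 2 := by
      unfold constB; field_simp; ring
    have h2 : alpha1 κ τ lam ν * alpha2 κ τ lam ν =
      √κ ^ 2 / 4 * (|ν| ^ 2 * √(constB τ lam ν) ^ 2 - constB τ lam ν ^ 2 / τ ^ 2) := by
      unfold alpha1 alpha2; ring
    rw [h2, hn2, hS2]
    linear_combination √κ ^ 2 / 4 * constB τ lam ν * this
  set a1 := alpha1 κ τ lam ν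
  set a2 := alpha2 κ τ lam ν
  have hB0 := hB.ne'
  refine isHopfHelix_torus (A := √(w11 κ τ lam ν)) (C := √(-w33 κ τ lam ν)) (a := a1) (c := a2)
    hκ hτ hlam hpos ?_ ?_ ?_
  · rw [e1, e3, ← mul_sub, show a2 - a1 = -(√κ * constB τ lam ν / τ) by rw [← hdiff]; ring]
    rw [show (-1 : ℝ) / (κ / 4) = -1 / (√κ ^ 2 / 4) by rw [hk2]]
    field_simp
  · rw [e1, e3]
    have : 4 * τ / (√κ ^ 3 * constB τ lam ν) * a2 * a1 ^ 2 -
        4 * τ / (√κ ^ 3 * constB τ lam ν) * a1 * a2 ^ 2 =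
        4 * τ / (√κ ^ 3 * constB τ lam ν) * (a1 * a2) * (a1 - a2) := by ring
    rw [this, hprod, hdiff]
    field_simp
  · rw [e1, e3]
    have : 4 * τ / (√κ ^ 3 * constB τ lam ν) * a2 * a1 +
        4 * τ / (√κ ^ 3 * constB τ lam ν) * a1 * a2 =
        8 * τ / (√κ ^ 3 * constB τ lam ν) * (a1 * a2) := by ring
    rw [this, hprod]
    field_simp
    ring

/-- The curve is a straight line, null for the flat metric; $B=0$ means $\nu^2\tau^2=\lambda+\nu^2$.
-/
lemma isHopfHelix_curveZero (hκ : 0 < κ) (hτ : 0 < τ) (hlam : lam = 1 ∨ lam = -1)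
    (hpos : 0 < lam + ν ^ 2) (hB : constB τ lam ν = 0) :
    (∀ x, gB κ τ (curveZero κ τ lam ν x) (deriv (curveZero κ τ lam ν) x)
        (deriv (curveZero κ τ lam ν) x) = -lam * (lam + ν ^ 2)) ∧
      IsHopfHelix κ τ (curveZero κ τ lam ν) (-lam * √(lam + ν ^ 2)) := by
  have hk : 0 < √κ := Real.sqrt_pos.2 hκ
  have hk2 : √κ ^ 2 = κ := Real.sq_sqrt hκ.le
  have hl2 : lam ^ 2 = 1 := by rcases hlam with rfl | rfl <;> norm_num
  have hd : ∀ x, deriv (curveZero κ τ lam ν) x = ![ν ^ 2 * τ, 0, 0, ν ^ 2 * τ * lam] := fun x =>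
    (hasDerivAt_vec4 (((hasDerivAt_id x).const_mul (ν ^ 2 * τ)).congr_deriv (mul_one _))
      (hasDerivAt_const x (0 : ℝ)) (hasDerivAt_const x (2 / √κ))
      (((hasDerivAt_id x).const_mul (ν ^ 2 * τ * lam)).congr_deriv (mul_one _))).deriv
  refine isHopfHelix_of_velocity hκ hτ hlam hpos ?_ (fun x => ?_) (fun x => ?_) (fun x => ?_)
  · apply contDiff_vec4 <;> fun_prop
  · change ip _ _ = _
    simp only [ip, curveZero, Matrix.cons_val]
    rw [show (-1 : ℝ) / (κ / 4) = -(2 / √κ * (2 / √κ)) by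
      nth_rewrite 1 [← hk2]; field_simp; norm_num]
    linear_combination -(ν ^ 2 * τ * x) ^ 2 * hl2
  · rw [hd, hB]
    simp only [ip, Matrix.cons_val]
    linear_combination -τ ^ 2 * (ν ^ 2 * τ) ^ 2 * hl2
  · rw [hd]
    simp only [ip, X1, J1, curveZero, Pi.smul_apply, smul_eq_mul, Matrix.cons_val]
    have : √κ / 2 * (2 / √κ) = 1 := by field_simp
    unfold constB at hB
    linear_combination -τ ^ 2 * ν ^ 2 * lam * this - lam * hB

/-- In complex form $\gamma=e^{i\alpha x}(p\sinh\beta x,\ A\cosh\beta x+ir\sinh\beta x)$ with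
$A=2/\sqrt\kappa$. The relation $p^2-r^2=A^2$ keeps it on the quadric and makes both scalar products
constant, equal to their values at $x=0$. -/
lemma isHopfHelix_curveNeg (hκ : 0 < κ) (hτ : 0 < τ) (hlam : lam = 1 ∨ lam = -1)
    (hpos : 0 < lam + ν ^ 2) (hB : constB τ lam ν < 0) :
    (∀ x, gB κ τ (curveNeg κ τ lam ν x) (deriv (curveNeg κ τ lam ν) x)
        (deriv (curveNeg κ τ lam ν) x) = -lam * (lam + ν ^ 2)) ∧
      IsHopfHelix κ τ (curveNeg κ τ lam ν) (-lam * √(lam + ν ^ 2)) := by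
  have hk : 0 < √κ := Real.sqrt_pos.2 hκ
  have hk2 : √κ ^ 2 = κ := Real.sq_sqrt hκ.le
  have hl2 : lam ^ 2 = 1 := by rcases hlam with rfl | rfl <;> norm_num
  have hn2 : |ν| ^ 2 = ν ^ 2 := sq_abs ν
  have hq2 : √(lam + ν ^ 2) ^ 2 = lam + ν ^ 2 := Real.sq_sqrt hpos.le
  -- With $D=\sqrt{-B}$ the radical $\sqrt{-\kappa B}$ splits as $\sqrt\kappa\,D$, which clears the
  -- nested roots from the parameters.
  obtain ⟨D, hD, hD2, hDs⟩ : ∃ D : ℝ, 0 < D ∧ D ^ 2 = -constB τ lam ν ∧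
      √(-κ * constB τ lam ν) = √κ * D :=
    ⟨√(-constB τ lam ν), Real.sqrt_pos.2 (by linarith), Real.sq_sqrt (by linarith), by
      rw [← Real.sqrt_mul hκ.le]; congr 1; ring⟩
  have hBD : constB τ lam ν = -D ^ 2 := by linarith
  have hBν : D ^ 2 = lam + ν ^ 2 - ν ^ 2 * τ ^ 2 := by rw [hD2]; unfold constB; ring
  set α := alphaNeg κ τ lam ν with hα
  set β := betaNeg κ τ lam ν with hβ
  set p := 2 * √(lam + ν ^ 2) / √(-κ * constB τ lam ν) with hp
  set r := 2 * lam * τ * |ν| / √(-κ * constB τ lam ν) with hr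
  set A := 2 / √κ with hA
  have hinv : lam⁻¹ = lam := inv_eq_of_mul_eq_one_left (by rw [← pow_two, hl2])
  have hα' : α = √κ / 2 * lam * D ^ 2 / τ := by
    rw [hα, alphaNeg, hBD, ← div_div, div_eq_mul_inv _ lam, hinv]; ring
  have hβ' : β = |ν| * √κ * D / 2 := by rw [hβ, betaNeg, hDs]; ring
  have hA2 : A ^ 2 * √κ ^ 2 = 4 := by rw [hA]; field_simp; norm_num
  have hp2 : p ^ 2 = A ^ 2 * (lam + ν ^ 2) / D ^ 2 := by
    rw [hp, hDs, div_pow, mul_pow, hq2, hA]; field_simp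
  have hr2 : r ^ 2 = A ^ 2 * (τ ^ 2 * ν ^ 2) / D ^ 2 := by
    rw [hr, hDs, div_pow, mul_pow, mul_pow, mul_pow, hl2, hn2, hA]; field_simp
  have hpr : p ^ 2 - r ^ 2 = A ^ 2 := by
    rw [hp2, hr2, ← sub_div, div_eq_iff (by positivity), hBν]; ring
  have hrβ : r * β = lam * τ * ν ^ 2 := by
    rw [hr, hβ', hDs, ← hn2]; field_simp
  have hAα : A * α = lam * D ^ 2 / τ := by rw [hA, hα']; field_simp
  have hAD : A * α + r * β = lam * (lam + ν ^ 2) / τ := by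
    rw [hAα, hrβ, hBν]; field_simp; ring
  have hβ2 : β ^ 2 * A ^ 2 = ν ^ 2 * D ^ 2 := by
    rw [hβ', div_pow, mul_pow, mul_pow, hn2]
    linear_combination ν ^ 2 * D ^ 2 / 4 * hA2
  have hd : ∀ x, deriv (curveNeg κ τ lam ν) x =
      ![p * (-α * Real.sin (α * x)) * Real.sinh (β * x) +
          p * Real.cos (α * x) * (β * Real.cosh (β * x)),
        p * (α * Real.cos (α * x)) * Real.sinh (β * x) +
          p * Real.sin (α * x) * (β * Real.cosh (β * x)),
        A * (-α * Real.sin (α * x)) * Real.cosh (β * x) +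
          A * Real.cos (α * x) * (β * Real.sinh (β * x)) -
          (r * (α * Real.cos (α * x)) * Real.sinh (β * x) +
          r * Real.sin (α * x) * (β * Real.cosh (β * x))),
        A * (α * Real.cos (α * x)) * Real.cosh (β * x) +
          A * Real.sin (α * x) * (β * Real.sinh (β * x)) +
          (r * (-α * Real.sin (α * x)) * Real.sinh (β * x) +
          r * Real.cos (α * x) * (β * Real.cosh (β * x)))] := fun x => by
    have c := hasDerivAt_cos_mul α x
    have s := hasDerivAt_sin_mul α x
    have ch := hasDerivAt_cosh_mul β x
    have sh := hasDerivAt_sinh_mul β x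
    exact (hasDerivAt_vec4 ((c.const_mul p).mul sh) ((s.const_mul p).mul sh)
      (((c.const_mul A).mul ch).sub ((s.const_mul r).mul sh))
      (((s.const_mul A).mul ch).add ((c.const_mul r).mul sh))).deriv
  have hsc : ∀ x, Real.sin (α * x) ^ 2 = 1 - Real.cos (α * x) ^ 2 := fun x => Real.sin_sq _
  have hch : ∀ x, Real.cosh (β * x) ^ 2 = Real.sinh (β * x) ^ 2 + 1 := fun x => Real.cosh_sq _
  -- At $x=0$ the velocity is $(p\beta,\ i(A\alpha+r\beta))$.
  have hvel : τ ^ 2 * (p ^ 2 * β ^ 2 - (A * α + r * β) ^ 2) =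
      (lam + ν ^ 2) * constB τ lam ν := by
    have : p ^ 2 * β ^ 2 = (lam + ν ^ 2) * ν ^ 2 := by
      rw [hp2, div_mul_eq_mul_div, div_eq_iff (by positivity)]
      linear_combination (lam + ν ^ 2) * hβ2
    rw [this, hAD, div_pow, mul_pow, hl2]
    unfold constB
    field_simp
    ring
  have hAk : √κ / 2 * A = 1 := by rw [hA]; field_simp
  have hbX : τ * (A * α + r * β) = lam * (lam + ν ^ 2) := by rw [hAD]; field_simp
  refine isHopfHelix_of_velocity hκ hτ hlam hpos ?_ (fun x => ?_) (fun x => ?_) (fun x => ?_)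
  · have hc : ContDiff ℝ ∞ (fun x => Real.cos (α * x)) := by fun_prop
    have hs : ContDiff ℝ ∞ (fun x => Real.sin (α * x)) := by fun_prop
    have hch : ContDiff ℝ ∞ (fun x => Real.cosh (β * x)) :=
      Real.contDiff_cosh.comp (contDiff_const.mul contDiff_id)
    have hsh : ContDiff ℝ ∞ (fun x => Real.sinh (β * x)) :=
      Real.contDiff_sinh.comp (contDiff_const.mul contDiff_id)
    exact contDiff_vec4 ((contDiff_const.mul hc).mul hsh) ((contDiff_const.mul hs).mul hsh)
      (((contDiff_const.mul hc).mul hch).sub ((contDiff_const.mul hs).mul hsh))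
      (((contDiff_const.mul hs).mul hch).add ((contDiff_const.mul hc).mul hsh))
  · change ip _ _ = _
    have : (-1 : ℝ) / (κ / 4) = -A ^ 2 := by
      rw [hA, div_pow, hk2]; field_simp; norm_num
    rw [this]
    simp only [ip, curveNeg, Matrix.cons_val]
    simp only [← hα, ← hβ, ← hp, ← hr, ← hA]
    linear_combination Real.sinh (β * x) ^ 2 * hpr +
      (p ^ 2 * Real.sinh (β * x) ^ 2 - A ^ 2 * Real.cosh (β * x) ^ 2 -
        r ^ 2 * Real.sinh (β * x) ^ 2) * hsc x - A ^ 2 * hch x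
  · rw [hd]
    simp only [ip, Matrix.cons_val]
    linear_combination hvel +
      τ ^ 2 * (p ^ 2 * β ^ 2 * Real.cosh (β * x) ^ 2 + p ^ 2 * α ^ 2 * Real.sinh (β * x) ^ 2 -
        (A * β - r * α) ^ 2 * Real.sinh (β * x) ^ 2 -
        (A * α + r * β) ^ 2 * Real.cosh (β * x) ^ 2) * hsc x +
      τ ^ 2 * (p ^ 2 * β ^ 2 - (A * α + r * β) ^ 2) * hch x +
      τ ^ 2 * (α ^ 2 + β ^ 2) * Real.sinh (β * x) ^ 2 * hpr
  · rw [hd]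
    simp only [ip, X1, J1, curveNeg, Pi.smul_apply, smul_eq_mul, Matrix.cons_val]
    simp only [← hα, ← hβ, ← hp, ← hr, ← hA]
    linear_combination -hbX - τ * (A * α + r * β) * hAk +
      τ * (√κ / 2) * (p ^ 2 * α * Real.sinh (β * x) ^ 2 +
        r * (A * β - r * α) * Real.sinh (β * x) ^ 2 -
        A * (A * α + r * β) * Real.cosh (β * x) ^ 2) * hsc x +
      τ * (√κ / 2) * α * Real.sinh (β * x) ^ 2 * hpr -
      τ * (√κ / 2) * A * (A * α + r * β) * hch x

end Curves

/-- The profile curves are Hopf helices of constant squared velocity `-λ (λ + ν²)`. -/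
theorem isHopfHelix_of_isProfileCurve {κ τ lam ν : ℝ} (hκ : 0 < κ) (hτ : 0 < τ)
    (hlam : lam = 1 ∨ lam = -1) (hν : ν ≠ 0) (hpos : 0 < lam + ν ^ 2) {γ : ℝ → R42}
    (hγ : IsProfileCurve κ τ lam ν γ) :
    (∀ x, gB κ τ (γ x) (deriv γ x) (deriv γ x) = -lam * (lam + ν ^ 2)) ∧
      IsHopfHelix κ τ γ (-lam * √(lam + ν ^ 2)) := by
  rcases hγ with ⟨hB, rfl⟩ | ⟨hB, rfl⟩ | ⟨hB, rfl⟩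
  · exact isHopfHelix_curvePos hκ hτ hlam hν hpos hB
  · exact isHopfHelix_curveZero hκ hτ hlam hpos hB
  · exact isHopfHelix_curveNeg hκ hτ hlam hpos hB

/-! ### Integral surfaces of the horizontal distribution -/

/-- At each point an integral map of the horizontal distribution `J₁q^⊥` has an image of its
differential that is isotropic for the curvature form `(u, v) ↦ ⟨u, J₁v⟩`. -/
lemma ip_J1_fderiv_eq_zero {E : Type*} [NormedAddCommGroup E] [NormedSpace ℝ E] {f : E → R42}
    {y : E} (hf : ContDiffAt ℝ ∞ f y) (h : ∀ᶠ z in nhds y, ∀ v, ip (fderiv ℝ f z v) (J1 (f z)) = 0)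
    (v w : E) : ip (fderiv ℝ f y v) (J1 (fderiv ℝ f y w)) = 0 := by
  have hsymm : IsSymmSndFDerivAt ℝ f y := hf.isSymmSndFDerivAt (by simpa using WithTop.coe_le_coe.2 (le_top (a := (2 : ℕ∞))))
  have hfd : HasFDerivAt f (fderiv ℝ f y) y := (hf.differentiableAt (by simp)).hasFDerivAt
  have hJ : HasFDerivAt (fun z => J1 (f z)) (J1L.comp (fderiv ℝ f y)) y :=
    J1L.hasFDerivAt.comp y hfd
  have hff : HasFDerivAt (fderiv ℝ f) (fderiv ℝ (fderiv ℝ f) y) y :=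
    ((hf.fderiv_right (m := 1) (by
      simpa [one_add_one_eq_two] using WithTop.coe_le_coe.2 (le_top (a := (2 : ℕ∞))))).differentiableAt (by simp)).hasFDerivAt
  -- Differentiate the horizontality of $\partial_v f$ in the direction $w$. Exchanging $v,w$ and
  -- subtracting removes the symmetric second derivative, while skewness of $J_1$ doubles the other
  -- term.
  have key : ∀ v w, ip (fderiv ℝ (fderiv ℝ f) y w v) (J1 (f y)) +
      ip (fderiv ℝ f y v) (J1 (fderiv ℝ f y w)) = 0 := fun v w => by
    obtain ⟨L, hL, hL'⟩ := hasFDerivAt_ip (hff.clm_apply (hasFDerivAt_const v y)) hJ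
    have h0 : HasFDerivAt (fun z => ip (fderiv ℝ f z v) (J1 (f z))) (0 : E →L[ℝ] ℝ) y :=
      (hasFDerivAt_const (0 : ℝ) y).congr_of_eventuallyEq (h.mono fun z hz => hz v)
    have := hL' w
    rw [hL.unique h0] at this
    simpa [J1L_apply] using this.symm
  have h1 := key v w
  have h2 := key w v
  rw [hsymm v w] at h2
  have h3 : ip (fderiv ℝ f y w) (J1 (fderiv ℝ f y v)) =
      -ip (fderiv ℝ f y v) (J1 (fderiv ℝ f y w)) := by
    rw [ip_comm, ip_J1_left]
  linarith

/-- Two horizontal tangent vectors on which the curvature form vanishes are linearly dependent. -/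
lemma dependent_of_horizontal {κ : ℝ} (hκ : 0 < κ) {q u v : R42} (hq : q ∈ antiDeSitter (κ / 4))
    (hu : IsTangentVec q u) (hv : IsTangentVec q v) (hu1 : ip u (X1 κ q) = 0)
    (hv1 : ip v (X1 κ q) = 0) (huv : ip u (J1 v) = 0) :
    ∃ s t : ℝ, (s ≠ 0 ∨ t ≠ 0) ∧ s • u + t • v = 0 := by
  have hcoord : ∀ a b c : ℝ, ip (a • X1 κ q + b • X2 κ q + c • X3 κ q) (X1 κ q) = -a := fun a b c => by
    have h1 : ip (X2 κ q) (X1 κ q) = 0 := by simp [ip, X1, X2, J1, J2]; ring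
    have h2 : ip (X3 κ q) (X1 κ q) = 0 := by simp [ip, X1, X3, J1, J3]; ring
    simp only [ip_add_left, ip_smul_left, ip_X1_X1 hκ hq, h1, h2]; ring
  obtain ⟨a, b, c, rfl⟩ := exists_frame_coords hκ hq hu
  obtain ⟨a', b', c', rfl⟩ := exists_frame_coords hκ hq hv
  rw [hcoord, neg_eq_zero] at hu1 hv1
  subst hu1 hv1
  have hqq : ip q q = -1 / (κ / 4) := hq
  -- On the plane of $X_2,X_3$ the curvature form is an area form, hence nondegenerate.
  have hdet : c * b' - b * c' = 0 := by
    have h1 : ip ((0 : ℝ) • X1 κ q + b • X2 κ q + c • X3 κ q)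
        (J1 ((0 : ℝ) • X1 κ q + b' • X2 κ q + c' • X3 κ q)) =
        -(√κ ^ 2 / 4) * ip q q * (c * b' - b * c') := by
      simp [ip, X1, X2, X3, J1, J2, J3]; ring
    rw [h1, Real.sq_sqrt hκ.le, hqq] at huv
    have : -(κ / 4) * (-1 / (κ / 4)) = 1 := by field_simp
    rw [this, one_mul] at huv
    exact huv
  by_cases hb : b = 0 ∧ c = 0
  · exact ⟨1, 0, by simp, by simp [hb.1, hb.2]⟩
  by_cases hb0 : b = 0
  · refine ⟨c', -c, Or.inr (neg_ne_zero.2 fun h => hb ⟨hb0, h⟩), ?_⟩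
    subst hb0
    have : b' = 0 := by
      have hc : c ≠ 0 := fun h => hb ⟨rfl, h⟩
      simpa [hc] using hdet
    subst this
    module
  · refine ⟨b', -b, Or.inr (neg_ne_zero.2 hb0), ?_⟩
    have : b' * c = b * c' := by linarith
    have h2 : b' • ((0 : ℝ) • X1 κ q + b • X2 κ q + c • X3 κ q) +
        -b • ((0 : ℝ) • X1 κ q + b' • X2 κ q + c' • X3 κ q) = (b' * c - b * c') • X3 κ q := by module
    rw [h2, this, sub_self, zero_smul]

/-! ### Immersed surfaces: non-integrability, tangent planes and causal type -/

section Surfaces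

variable {M : Type*} [TopologicalSpace M] [ChartedSpace (EuclideanSpace ℝ (Fin 2)) M]

/-- The differential of `F` at `p` as a linear map on the model space. -/
noncomputable def dFL (F : M → R42) (p : M) : EuclideanSpace ℝ (Fin 2) →L[ℝ] R42 :=
  mfderiv (𝓡 2) 𝓘(ℝ, R42) F p

/-- The manifold differential at $p$ is the ordinary derivative in the preferred chart at $p$, and
only at that point of the chart. -/
lemma hasFDerivAt_dFL {F : M → R42} (hF : ContMDiff (𝓡 2) 𝓘(ℝ, R42) ∞ F) (p : M) :
    HasFDerivAt (F ∘ (extChartAt (𝓡 2) p).symm) (dFL F p) (extChartAt (𝓡 2) p p) := by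
  have h : MDifferentiableAt (𝓡 2) 𝓘(ℝ, R42) F p := (hF p).mdifferentiableAt (by simp)
  have h2 : HasFDerivWithinAt (F ∘ (extChartAt (𝓡 2) p).symm) (dFL F p) (Set.range (𝓡 2))
      (extChartAt (𝓡 2) p p) := h.hasMFDerivAt.2
  rwa [modelWithCornersSelf_coe, Set.range_id, hasFDerivWithinAt_univ] at h2

lemma isTangentVec_dFL {κ : ℝ} {F : M → R42} (hF : ContMDiff (𝓡 2) 𝓘(ℝ, R42) ∞ F)
    (hmem : ∀ p, F p ∈ antiDeSitter (κ / 4)) (p : M) (v : EuclideanSpace ℝ (Fin 2)) :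
    IsTangentVec (F p) (dFL F p v) := by
  have h := hasFDerivAt_dFL hF p
  obtain ⟨L, hL, hL'⟩ := hasFDerivAt_ip h h
  have h0 : HasFDerivAt (fun z => ip ((F ∘ (extChartAt (𝓡 2) p).symm) z)
      ((F ∘ (extChartAt (𝓡 2) p).symm) z)) (0 : EuclideanSpace ℝ (Fin 2) →L[ℝ] ℝ)
      (extChartAt (𝓡 2) p p) :=
    (hasFDerivAt_const (-1 / (κ / 4)) _).congr_of_eventuallyEq (.of_forall fun z => hmem _)
  have := hL' v
  rw [hL.unique h0, ip_comm (dFL F p v)] at this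
  simp only [zero_apply, Function.comp_apply, extChartAt_to_inv] at this
  change ip _ _ = 0
  linarith

/-- There is no horizontal immersed surface: the distribution orthogonal to the Hopf fibers is not
integrable. -/
theorem not_horizontal_immersion [IsManifold (𝓡 2) ∞ M] {κ : ℝ} (hκ : 0 < κ) {F : M → R42} (hF : ContMDiff (𝓡 2) 𝓘(ℝ, R42) ∞ F) (hmem : ∀ p, F p ∈ antiDeSitter (κ / 4))
    (hhor : ∀ p v, ip (dF F p v) (X1 κ (F p)) = 0) (p : M) :
    ¬ Function.Injective (dF F p) := by
  intro hinj
  set φ := extChartAt (𝓡 2) p with hφ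
  have hopen : IsOpen φ.target := isOpen_extChartAt_target p
  have hsm : ContMDiffOn 𝓘(ℝ, EuclideanSpace ℝ (Fin 2)) (𝓡 2) ∞ φ.symm φ.target :=
    contMDiffOn_extChartAt_symm p
  -- Away from $p$ the chart derivative is $dF$ composed with the derivative of the inverse chart;
  -- its values are still values of $dF$, hence horizontal.
  have hfd : ∀ y ∈ φ.target, ∀ v, ∃ w, fderiv ℝ (F ∘ φ.symm) y v = dF F (φ.symm y) w :=
    fun y hy v => by
    have h1 : MDifferentiableAt 𝓘(ℝ, EuclideanSpace ℝ (Fin 2)) (𝓡 2) φ.symm y :=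
      (hsm.contMDiffAt (hopen.mem_nhds hy)).mdifferentiableAt (by simp)
    have h2 : MDifferentiableAt (𝓡 2) 𝓘(ℝ, R42) F (φ.symm y) :=
      (hF _).mdifferentiableAt (by simp)
    refine ⟨mfderiv 𝓘(ℝ, EuclideanSpace ℝ (Fin 2)) (𝓡 2) φ.symm y v, ?_⟩
    rw [← mfderiv_eq_fderiv, mfderiv_comp y h2 h1]
    rfl
  have hy : φ p ∈ φ.target := mem_extChartAt_target p
  have hfs : ContDiffAt ℝ ∞ (F ∘ φ.symm) (φ p) := by
    rw [← contMDiffAt_iff_contDiffAt]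
    exact (hF _).comp _ (hsm.contMDiffAt (hopen.mem_nhds hy))
  have hk : √κ / 2 ≠ 0 := by have := Real.sqrt_pos.2 hκ; positivity
  have hev : ∀ᶠ z in nhds (φ p), ∀ v,
      ip (fderiv ℝ (F ∘ φ.symm) z v) (J1 ((F ∘ φ.symm) z)) = 0 := by
    filter_upwards [hopen.mem_nhds hy] with z hz v
    obtain ⟨w, hw⟩ := hfd z hz v
    have := hhor (φ.symm z) w
    rw [X1_eq, ip_smul_right, mul_eq_zero] at this
    rw [hw]
    exact this.resolve_left hk
  have hd := (hasFDerivAt_dFL hF p).fderiv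
  have htan := isTangentVec_dFL hF hmem p
  obtain ⟨s, t, hst, h0⟩ := dependent_of_horizontal hκ (hmem p)
    (htan (EuclideanSpace.single 0 1)) (htan (EuclideanSpace.single 1 1)) (hhor p _) (hhor p _)
    (by rw [← hd]; exact ip_J1_fderiv_eq_zero hfs hev _ _)
  have hL : s • EuclideanSpace.single (0 : Fin 2) (1 : ℝ) + t • EuclideanSpace.single 1 1 = 0 := by
    apply hinj
    change dFL F p _ = dFL F p _
    rw [map_zero, map_add, map_smul, map_smul]
    exact h0
  have hs := congrArg (fun x : EuclideanSpace ℝ (Fin 2) => x 0) hL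
  have ht := congrArg (fun x : EuclideanSpace ℝ (Fin 2) => x 1) hL
  simp at hs ht
  rcases hst with h | h <;> contradiction

/-- The image of the differential is the orthogonal complement of the normal. -/
lemma exists_dFL_eq {κ τ lam : ℝ} (hκ : 0 < κ) {F N : M → R42}
    (h : IsOrientedSurface κ τ F N lam) (p : M) {u : R42} (hu : IsTangentVec (F p) u)
    (huN : gB κ τ (F p) u (N p) = 0) : ∃ v, dFL F p v = u := by
  -- The kernel of $S$ is the tangent vectors orthogonal to $N$. It has dimension $4-2$, that of the
  -- image of the injective differential, so the inclusion is an equality.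
  let S : R42 →ₗ[ℝ] (Fin 2 → ℝ) :=
    { toFun := fun u => ![ip u (F p), gB κ τ (F p) u (N p)]
      map_add' := fun u v => by
        ext i; fin_cases i <;> simp [ip_add_left, gB_add_left]
      map_smul' := fun s u => by
        ext i; fin_cases i <;> simp [ip_smul_left, gB_smul_left] }
  have hS : ∀ u, S u = ![ip u (F p), gB κ τ (F p) u (N p)] := fun u => rfl
  have hmem : ip (F p) (F p) = -1 / (κ / 4) := h.mem p
  have hlam : lam ≠ 0 := by rcases h.sign with h | h <;> rw [h] <;> norm_num
  have hFN : ip (F p) (N p) = 0 := h.tangent_normal p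
  have hsurj : LinearMap.range S = ⊤ := by
    rw [LinearMap.range_eq_top]
    intro y
    -- $F$ and $N$ are orthogonal for both forms, with squared lengths $-4/\kappa$ (flat) and
    -- $\lambda$ (for $g_\tau$).
    refine ⟨(-(κ / 4) * y 0) • F p + (y 1 / lam) • N p, ?_⟩
    have h1 : gB κ τ (F p) (F p) (N p) = 0 := by
      have : ip (F p) (X1 κ (F p)) = 0 := (isTangentVec_frame κ (F p)).1
      simp [gB, hFN, this]
    rw [hS, ip_add_left, ip_smul_left, ip_smul_left, gB_add_left, gB_smul_left, gB_smul_left,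
      h1, h.unit, ip_comm (N p), hFN, hmem]
    ext i
    fin_cases i
    · simp; field_simp
    · simp; field_simp
  have hker : Module.finrank ℝ (LinearMap.ker S) = 2 := by
    have := S.finrank_range_add_finrank_ker
    rw [hsurj, finrank_top] at this
    simp at this
    omega
  have hinj : Function.Injective (dFL F p) := h.immersion p
  have hrange : Module.finrank ℝ (LinearMap.range (dFL F p).toLinearMap) = 2 := by
    rw [LinearMap.finrank_range_of_inj hinj]
    simp
  have hle : LinearMap.range (dFL F p).toLinearMap ≤ LinearMap.ker S := by
    rintro _ ⟨v, rfl⟩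
    rw [LinearMap.mem_ker, hS]
    have h1 : ip (dFL F p v) (F p) = 0 := by
      rw [ip_comm]; exact isTangentVec_dFL h.smooth h.mem p v
    have h2 : gB κ τ (F p) (dFL F p v) (N p) = 0 := h.normal p v
    ext i
    fin_cases i
    · exact h1
    · exact h2
  have heq := Submodule.eq_of_le_of_finrank_eq hle (hrange.trans hker.symm)
  have : u ∈ LinearMap.ker S := by
    rw [LinearMap.mem_ker, hS, huN, ip_comm, show ip (F p) u = 0 from hu]
    ext i; fin_cases i <;> rfl
  rw [← heq] at this
  exact this

/-- Hopf frame coordinates of the unit normal of a helix surface. -/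
lemma IsHelixSurface.normal_coords {κ τ lam ν : ℝ} (hκ : 0 < κ) (hτ : 0 < τ) {F N : M → R42}
    (h : IsHelixSurface κ τ F N lam ν) (p : M) : ∃ b c : ℝ, b ^ 2 + c ^ 2 = lam + ν ^ 2 ∧
      N p = (-lam * ν / τ) • X1 κ (F p) + b • X2 κ (F p) + c • X3 κ (F p) := by
  obtain ⟨a, b, c, hN⟩ := exists_frame_coords hκ (h.mem p) (h.tangent_normal p)
  have hl2 : lam ^ 2 = 1 := by rcases h.sign with h | h <;> rw [h] <;> norm_num
  have hE : E1 κ τ (F p) = τ⁻¹ • X1 κ (F p) + (0 : ℝ) • X2 κ (F p) + (0 : ℝ) • X3 κ (F p) := by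
    simp [E1]
  have hang := h.angle p
  have hunit := h.unit p
  rw [hN, hE, gB_frame_comb hκ τ (h.mem p)] at hang
  rw [hN, gB_frame_comb hκ τ (h.mem p)] at hunit
  have ha : a * τ = -lam * ν := by
    have : τ * (τ⁻¹) = 1 := mul_inv_cancel₀ hτ.ne'
    linear_combination -lam * hang - a * τ * hl2 - lam ^ 2 * τ * a * this
  have ha' : a = -lam * ν / τ := by rw [eq_div_iff hτ.ne', ha]
  refine ⟨b, c, ?_, ha' ▸ hN⟩
  linear_combination hunit + (a * τ - lam * ν) * ha + ν ^ 2 * hl2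

/-- If $b^2+c^2=\lambda+\nu^2$ vanished, $N$ would be a nonzero multiple of $E_1$ at every point and
the immersion horizontal. -/
theorem IsHelixSurface.pos {κ τ lam ν : ℝ} (hκ : 0 < κ) (hτ : 0 < τ) [IsManifold (𝓡 2) ∞ M]
    [Nonempty M] {F N : M → R42} (h : IsHelixSurface κ τ F N lam ν) (hν : ν ≠ 0) :
    0 < lam + ν ^ 2 := by
  have hl0 : lam ≠ 0 := by rcases h.sign with h | h <;> rw [h] <;> norm_num
  obtain ⟨p⟩ := ‹Nonempty M›
  have hnn : 0 ≤ lam + ν ^ 2 := by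
    obtain ⟨b, c, hbc, -⟩ := h.normal_coords hκ hτ p
    rw [← hbc]; positivity
  refine hnn.lt_of_ne fun h0 => ?_
  refine not_horizontal_immersion hκ h.smooth h.mem (fun p v => ?_) p (h.immersion p)
  obtain ⟨b, c, hbc, hN⟩ := h.normal_coords hκ hτ p
  rw [← h0] at hbc
  have hb : b = 0 := by nlinarith [sq_nonneg b, sq_nonneg c]
  have hc : c = 0 := by nlinarith [sq_nonneg b, sq_nonneg c]
  have hNE : N p = (-lam * ν) • E1 κ τ (F p) := by
    rw [hN, hb, hc, E1, smul_smul, div_eq_mul_inv]; simp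
  have hn := h.normal p v
  rw [hNE, gB_smul_right, gB_E1_right hκ hτ (h.mem p)] at hn
  simpa [hl0, hν, hτ.ne'] using hn

theorem IsHelixSurface.isTimelikeSurface {κ τ ν : ℝ} (hκ : 0 < κ) (hτ : 0 < τ)
    {F N : M → R42} (h : IsHelixSurface κ τ F N 1 ν) : IsTimelikeSurface κ τ F := by
  intro p
  obtain ⟨b, c, hbc, hN⟩ := h.normal_coords hκ hτ p
  have hq := h.mem p
  have key : ∀ x y z : ℝ, -τ ^ 2 * x * (-1 * ν / τ) + y * b + z * c = 0 →
      ∃ v, gB κ τ (F p) (dF F p v) (dF F p v) = -τ ^ 2 * x * x + y * y + z * z :=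
    fun x y z hxyz => by
      obtain ⟨v, hv⟩ := exists_dFL_eq hκ h.toIsOrientedSurface p
        (isTangentVec_frame_comb κ (F p) x y z) (by rw [hN, gB_frame_comb hκ τ hq, hxyz])
      refine ⟨v, ?_⟩
      change gB κ τ (F p) (dFL F p v) (dFL F p v) = _
      rw [hv, gB_frame_comb hκ τ hq]
  constructor
  -- The vector $-(E_1-\nu N)$, minus the tangential projection of $E_1$.
  · obtain ⟨v, hv⟩ := key (-(1 + ν ^ 2) / τ) (ν * b) (ν * c) (by
      field_simp; linear_combination ν * hbc)
    refine ⟨v, ?_⟩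
    have : gB κ τ (F p) (dF F p v) (dF F p v) = -(1 + ν ^ 2) := by
      rw [hv]; field_simp; linear_combination ν ^ 2 * hbc
    rw [this]; nlinarith [sq_nonneg ν]
  -- The horizontal part of $N$ turned by a right angle.
  · obtain ⟨v, hv⟩ := key 0 (-c) b (by ring)
    refine ⟨v, ?_⟩
    have : gB κ τ (F p) (dF F p v) (dF F p v) = 1 + ν ^ 2 := by
      rw [hv]; linear_combination hbc
    rw [this]; positivity

/-- The complement of a timelike vector in a Lorentzian space is positive definite: for a
non-spacelike $u\perp N$, Cauchy–Schwarz on the horizontal parts and $\tau^2a'^2=1+b'^2+c'^2$ force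
$u=0$. -/
theorem IsOrientedSurface.isSpacelikeSurface {κ τ : ℝ} (hκ : 0 < κ) (hτ : 0 < τ)
    {F N : M → R42} (h : IsOrientedSurface κ τ F N (-1)) : IsSpacelikeSurface κ τ F := by
  intro p v hv
  have hq := h.mem p
  obtain ⟨a', b', c', hN⟩ := exists_frame_coords hκ hq (h.tangent_normal p)
  obtain ⟨a, b, c, hu⟩ := exists_frame_coords hκ hq (isTangentVec_dFL h.smooth h.mem p v)
  have hinj : Function.Injective (dFL F p) := h.immersion p
  have hunit := h.unit p
  have hn : gB κ τ (F p) (dFL F p v) (N p) = 0 := h.normal p v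
  have hu0 : dFL F p v ≠ 0 := fun h0 => hv (hinj (h0.trans (map_zero _).symm))
  change 0 < gB κ τ (F p) (dFL F p v) (dFL F p v)
  rw [hN, gB_frame_comb hκ τ hq] at hunit
  rw [hu, hN, gB_frame_comb hκ τ hq] at hn
  rw [hu, gB_frame_comb hκ τ hq]
  by_contra hle
  rw [not_lt] at hle
  have hcs : (τ * a) ^ 2 * (1 + (b' ^ 2 + c' ^ 2)) ≤ (b ^ 2 + c ^ 2) * (b' ^ 2 + c' ^ 2) := by
    have e1 : (τ * a) ^ 2 * (1 + (b' ^ 2 + c' ^ 2)) = (b * b' + c * c') ^ 2 := by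
      have : b * b' + c * c' = τ ^ 2 * a * a' := by linear_combination hn
      rw [this]
      linear_combination (τ * a) ^ 2 * hunit
    rw [e1]
    nlinarith [sq_nonneg (b * c' - c * b')]
  have hle' : b ^ 2 + c ^ 2 ≤ (τ * a) ^ 2 := by linarith
  have h2 := mul_le_mul_of_nonneg_right hle' (by positivity : 0 ≤ b' ^ 2 + c' ^ 2)
  have hta : (τ * a) ^ 2 = 0 := le_antisymm (by linarith) (sq_nonneg _)
  have ha : a = 0 := by simpa [hτ.ne'] using hta
  have hb : b = 0 := by nlinarith [sq_nonneg b, sq_nonneg c]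
  have hc : c = 0 := by nlinarith [sq_nonneg b, sq_nonneg c]
  exact hu0 (by rw [hu, ha, hb, hc]; simp)

/-- A point is needed: on an empty surface both conditions hold vacuously. -/
lemma not_isSpacelikeSurface_of_isTimelikeSurface [Nonempty M] {κ τ : ℝ} {F : M → R42}
    (h : IsTimelikeSurface κ τ F) : ¬ IsSpacelikeSurface κ τ F := by
  intro hs
  obtain ⟨p⟩ := ‹Nonempty M›
  obtain ⟨⟨v, hv⟩, -⟩ := h p
  have hv0 : v ≠ 0 := by
    rintro rfl
    have : dF F p 0 = 0 := map_zero (dFL F p)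
    rw [this] at hv
    simp [gB, ip] at hv
  exact lt_asymm hv (hs p v hv0)

end Surfaces

end BergerAdS

theorem proposition7p1 (κ τ : ℝ) (hκ : 0 < κ) (hτ : 0 < τ) :
    -- `E₁` spans the tangent lines of the Hopf fibers
    (∀ q ∈ BergerAdS.antiDeSitter (κ / 4), ∀ v : BergerAdS.R42,
      BergerAdS.IsFiberDirection κ q v ↔ ∃ s : ℝ, v = s • BergerAdS.E1 κ τ q) ∧
    -- the curves, for all admissible constants
    (∀ (lam ν : ℝ) (γ : ℝ → BergerAdS.R42), (lam = 1 ∨ lam = -1) → ν ≠ 0 → 0 < lam + ν ^ 2 →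
      BergerAdS.IsProfileCurve κ τ lam ν γ →
        (lam = -1 → BergerAdS.IsSpacelikeCurve κ τ γ) ∧
        (lam = 1 → BergerAdS.IsTimelikeCurve κ τ γ) ∧
        BergerAdS.IsHopfHelix κ τ γ (-lam * √(lam + ν ^ 2))) ∧
    -- the curve of a helix surface
    (∀ (M : Type*) [TopologicalSpace M] [ChartedSpace (EuclideanSpace ℝ (Fin 2)) M]
      [IsManifold (𝓡 2) ∞ M] [Nonempty M] (F N : M → BergerAdS.R42) (lam ν : ℝ),
      BergerAdS.IsHelixSurface κ τ F N lam ν → ν ≠ 0 →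
        0 < lam + ν ^ 2 ∧
        (BergerAdS.IsSpacelikeSurface κ τ F ∨ BergerAdS.IsTimelikeSurface κ τ F) ∧
        ∀ γ : ℝ → BergerAdS.R42, BergerAdS.IsProfileCurve κ τ lam ν γ →
          (BergerAdS.IsSpacelikeSurface κ τ F ↔ BergerAdS.IsSpacelikeCurve κ τ γ) ∧
          (BergerAdS.IsTimelikeSurface κ τ F ↔ BergerAdS.IsTimelikeCurve κ τ γ) ∧
          BergerAdS.IsHopfHelix κ τ γ (-lam * √(lam + ν ^ 2))) := by
  -- The squared speed is the constant $-\lambda(\lambda+\nu^2)$, so its sign is that of $-\lambda$.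
  have curves : ∀ (lam ν : ℝ) (γ : ℝ → BergerAdS.R42), (lam = 1 ∨ lam = -1) → ν ≠ 0 →
      0 < lam + ν ^ 2 → BergerAdS.IsProfileCurve κ τ lam ν γ →
      (BergerAdS.IsSpacelikeCurve κ τ γ ↔ lam = -1) ∧ (BergerAdS.IsTimelikeCurve κ τ γ ↔ lam = 1) ∧
        BergerAdS.IsHopfHelix κ τ γ (-lam * √(lam + ν ^ 2)) := fun lam ν γ hlam hν hpos hγ => by
    obtain ⟨hg, hh⟩ := BergerAdS.isHopfHelix_of_isProfileCurve hκ hτ hlam hν hpos hγ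
    simp only [BergerAdS.IsSpacelikeCurve, BergerAdS.IsTimelikeCurve, hg, forall_const]
    refine ⟨⟨fun h => hlam.resolve_left ?_, ?_⟩, ⟨fun h => hlam.resolve_right ?_, ?_⟩, hh⟩
    all_goals rintro rfl; linarith
  refine ⟨fun q hq v => BergerAdS.isFiberDirection_iff hκ hτ hq v, ?_, ?_⟩
  · intro lam ν γ hlam hν hpos hγ
    obtain ⟨h1, h2, h3⟩ := curves lam ν γ hlam hν hpos hγ
    exact ⟨h1.2, h2.2, h3⟩
  · intro M _ _ _ _ F N lam ν h hν
    have hpos := h.pos hκ hτ hν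
    -- The comparison of surface and curve passes through $\lambda$, which determines both types.
    obtain ⟨hS, hT⟩ : (BergerAdS.IsSpacelikeSurface κ τ F ↔ lam = -1) ∧
        (BergerAdS.IsTimelikeSurface κ τ F ↔ lam = 1) := by
      rcases h.sign with rfl | rfl
      · have ht := h.isTimelikeSurface hκ hτ
        have hs := BergerAdS.not_isSpacelikeSurface_of_isTimelikeSurface ht
        norm_num [ht, hs]
      · have hs := h.isSpacelikeSurface hκ hτ
        have ht := mt BergerAdS.not_isSpacelikeSurface_of_isTimelikeSurface (not_not.2 hs)
        norm_num [ht, hs]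
    refine ⟨hpos, ?_, fun γ hγ => ?_⟩
    · rw [hS, hT]; exact h.sign.symm
    · obtain ⟨h1, h2, h3⟩ := curves lam ν γ h.sign hν hpos hγ
      exact ⟨hS.trans h1.symm, hT.trans h2.symm, h3⟩
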